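/- \textbf{Theorem} (log-concavity of majority-winning probabilities). Let $N\ge 1$ and $\mathcal N=\{1,\dots,2N+1\}$. For each team $i\in\{A,B\}$ and each battle $t\in\mathcal N$ let $c_{it}>0$ be a marginal cost, $r_t\in(0,1]$ a discriminatory power, and $W_i>0$ a budget. Let \[ \Delta_i=\Bigl\{v\in\mathbb R^{2N+1}: v_t\ge 0 \text{ for all } t,\ \sum_{t\in\mathcal N} v_t=W_i\Bigr\}, \] and let $\operatorname{int}(\Delta_i)$ be its relative interior, i.e. the set of $v\in\Delta_i$ with $v_t>0$ for all $t$. For $\mathbf v_A\in\operatorname{int}(\Delta_A)$ and $\mathbf v_B\in\operatorname{int}(\Delta_B)$ define the battle-winning probabilities \[ p_{At}=\frac{(v_{At}/c_{At})^{r_t}}{(v_{At}/c_{At})^{r_t}+(v_{Bt}/c_{Bt})^{r_t}},\qquad p_{Bt}=1-p_{At}, \] and the majority-winning probability of team $i$, with rival $j\ne i$, \[ \mathrm{Prob}_i(\mathbf v_A,\mathbf v_B)=\sum_{\substack{w\subseteq\mathcal N\\ |w|\ge N+1}}\ \prod_{t\in w}p_{it}\prod_{q\in\mathcal N\setminus w}p_{jq}.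 \] Then for each $i\in\{A,B\}$ and each fixed allocation $\mathbf v_j\in\operatorname{int}(\Delta_j)$ of the rival $j\neq i$, the map $\mathbf v_i\mapsto \mathrm{Prob}_i(\mathbf v_A,\mathbf v_B)$ is log-concave on $\operatorname{int}(\Delta_i)$: it is positive there, and its logarithm is concave on $\operatorname{int}(\Delta_i)$. -/

import Mathlib

/-- The two teams. -/
inductive Team : Type
  | A
  | B
  deriving DecidableEq

/-- The rival `j ≠ i` of team `i`. -/
def Team.rival : Team → Team
  | .A => .B
  | .B => .A

/-- The strategy space of a manager with budget `W`: nonnegative divisions of `W` among the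
`2N + 1` battles. -/
def allocations (N : ℕ) (W : ℝ) : Set (Fin (2 * N + 1) → ℝ) :=
  {v | (∀ t, 0 ≤ v t) ∧ ∑ t, v t = W}

/-- The relative interior of the strategy space. -/
def interiorAllocations (N : ℕ) (W : ℝ) : Set (Fin (2 * N + 1) → ℝ) :=
  intrinsicInterior ℝ (allocations N W)

/-- For a positive budget the relative interior consists of the strictly positive allocations. -/
theorem mem_interiorAllocations_iff {N : ℕ} {W : ℝ} (hW : 0 < W) (v : Fin (2 * N + 1) → ℝ) :
    v ∈ interiorAllocations N W ↔ (∀ t, 0 < v t) ∧ ∑ t, v t = W := by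
  have hspan : ∀ x ∈ affineSpan ℝ (allocations N W), ∑ t, x t = W := by
    intro x hx
    refine affineSpan_induction (p := fun x => ∑ t, x t = W) hx (fun y hy => hy.2) ?_
    intro a u w z hu hw hz
    simp only [vsub_eq_sub, vadd_eq_add, Pi.add_apply, Pi.smul_apply, Pi.sub_apply, smul_eq_mul,
      Finset.sum_add_distrib, ← Finset.mul_sum, Finset.sum_sub_distrib, hu, hw, hz]
    ring
  have hn : (0 : ℝ) < 2 * N + 1 := by positivity
  unfold interiorAllocations
  rw [mem_intrinsicInterior]
  constructor
  · rintro ⟨y, hy, rfl⟩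
    have hyS : (y : Fin (2 * N + 1) → ℝ) ∈ allocations N W :=
      Set.mem_preimage.mp (interior_subset hy)
    refine ⟨fun t => ?_, hyS.2⟩
    set b : Fin (2 * N + 1) → ℝ := fun _ => W / (2 * N + 1) with hb
    have hbS : b ∈ allocations N W := by
      refine ⟨fun _ => by positivity, ?_⟩
      simp [hb]
      field_simp
    have hline : ∀ s : ℝ, AffineMap.lineMap b (y : Fin (2 * N + 1) → ℝ) s ∈
        affineSpan ℝ (allocations N W) := fun s =>
      AffineMap.lineMap_mem s (subset_affineSpan ℝ _ hbS) y.2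
    let g : ℝ → affineSpan ℝ (allocations N W) := fun s => ⟨_, hline s⟩
    have hg : Continuous g := by
      refine Continuous.subtype_mk ?_ _
      exact AffineMap.lineMap_continuous
    have hg1 : g 1 = y := by ext; simp [g]
    have hmem : ∀ᶠ s in nhds (1 : ℝ), g s ∈
        ((↑) ⁻¹' allocations N W : Set (affineSpan ℝ (allocations N W))) := by
      have := (hg.tendsto 1) (by rw [hg1]; exact mem_interior_iff_mem_nhds.mp hy)
      exact this
    obtain ⟨s, hs, hs1⟩ := ((hmem.filter_mono nhdsWithin_le_nhds).and
      (self_mem_nhdsWithin : ∀ᶠ s in nhdsWithin (1 : ℝ) (Set.Ioi 1), s ∈ Set.Ioi (1 : ℝ))).exists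
    have h0 : 0 ≤ (1 - s) * (W / (2 * N + 1)) + s * (y : Fin (2 * N + 1) → ℝ) t := by
      have := hs.1 t
      simpa [g, AffineMap.lineMap_apply_module, hb] using this
    have hs1' : 1 < s := hs1
    have hWn : 0 < W / (2 * N + 1) := by positivity
    by_contra hneg
    push Not at hneg
    nlinarith [mul_pos (sub_pos.mpr hs1') hWn]
  · rintro ⟨hpos, hsum⟩
    have hvS : v ∈ allocations N W := ⟨fun t => (hpos t).le, hsum⟩
    refine ⟨⟨v, subset_affineSpan ℝ _ hvS⟩, ?_, rfl⟩
    rw [mem_interior]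
    refine ⟨{y | ∀ t, 0 < (y : Fin (2 * N + 1) → ℝ) t}, ?_, ?_, hpos⟩
    · intro y hy
      exact ⟨fun t => (hy t).le, hspan _ y.2⟩
    · simp only [Set.ofPred_forall]
      exact isOpen_iInter_of_finite fun t => isOpen_lt continuous_const
        ((continuous_apply t).comp continuous_subtype_val)

/-- The equilibrium probability that team `A` wins battle `t`, where `c` are the marginal costs,
`r` the discriminatory powers and `v` the prize allocations. It is meant for prize shares that do
not both vanish, and is used below for strictly positive shares only. -/
noncomputable def battleProbA {N : ℕ} (c : Team → Fin (2 * N + 1) → ℝ) (r : Fin (2 * N + 1) → ℝ)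
    (v : Team → Fin (2 * N + 1) → ℝ) (t : Fin (2 * N + 1)) : ℝ :=
  (v .A t / c .A t) ^ r t / ((v .A t / c .A t) ^ r t + (v .B t / c .B t) ^ r t)

/-- The equilibrium probability that team `i` wins battle `t`. -/
noncomputable def battleProb {N : ℕ} (c : Team → Fin (2 * N + 1) → ℝ) (r : Fin (2 * N + 1) → ℝ)
    (v : Team → Fin (2 * N + 1) → ℝ) : Team → Fin (2 * N + 1) → ℝ
  | .A, t => battleProbA c r v t
  | .B, t => 1 - battleProbA c r v t

/-- The probability that team `i` wins the contest: the sum over its winning coalitions, the sets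
`w` of at least `N + 1` battles, of the probability that it wins exactly the battles in `w`. -/
noncomputable def contestProb {N : ℕ} (c : Team → Fin (2 * N + 1) → ℝ) (r : Fin (2 * N + 1) → ℝ)
    (v : Team → Fin (2 * N + 1) → ℝ) (i : Team) : ℝ :=
  ∑ w : Finset (Fin (2 * N + 1)) with N + 1 ≤ w.card,
    (∏ t ∈ w, battleProb c r v i t) * ∏ q ∈ wᶜ, battleProb c r v i.rival q

/-- `f` is log-concave on `s`: it is positive on `s` and `log f` is concave on `s` (in particular
`s` is convex). -/
def LogConcaveOn {E : Type*} [AddCommMonoid E] [Module ℝ E] (s : Set E) (f : E → ℝ) : Prop :=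
  (∀ x ∈ s, 0 < f x) ∧ ConcaveOn ℝ s (fun x => Real.log (f x))

/-! With odds y = p / (1 - p), the winning probability is S / ∏ (1 + y), where S sums the products
of odds over the sets of at least N + 1 battles. In the coordinates l = log (1 + y), the logarithm
of the denominator is linear and log S is concave (`concaveOn_log_tailSum_expPairs`). The
probability is nondecreasing in each odds (`tailSum_mul_prod_le`), and l is concave in the
allocation because r ≤ 1. A nondecreasing concave function of concave functions is concave
(`logConcaveOn_of_odds`).

Concavity of log S amounts to S S'' ≤ S'² along lines in l (`tailSum_mul_deriv2_le`). After one
battle is split off, S'² - S S'' is a quadratic in its velocity d whose minimiser does not depend on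
its odds y, so `logConcave_step` reduces the claim to y = 0. Such a battle still contributes to the
derivatives and stays in the list. The induction ends when the threshold is 0 or equals the number
of positive odds, where the jets are explicit. -/

/-! ### Tail sums and their jets -/

/-- The sum of `∏ y` over the sublists of size at least `k` of a list of pairs `(y, d)`. -/
noncomputable def tailSum : List (ℝ × ℝ) → ℕ → ℝ
  | [], k => if k = 0 then 1 else 0
  | p :: L, k => tailSum L k + p.1 * tailSum L (k - 1)

/-- The first derivative of `tailSum` along the curve on which `1 + y` grows at the rate `d`. -/
noncomputable def tailSumDeriv : List (ℝ × ℝ) → ℕ → ℝ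
  | [], _ => 0
  | p :: L, k => tailSumDeriv L k + p.1 * tailSumDeriv L (k - 1)
      + p.2 * (1 + p.1) * tailSum L (k - 1)

/-- The second derivative of `tailSum` along the curve on which `1 + y` grows at the rate `d`. -/
noncomputable def tailSumDeriv2 : List (ℝ × ℝ) → ℕ → ℝ
  | [], _ => 0
  | p :: L, k => tailSumDeriv2 L k + p.1 * tailSumDeriv2 L (k - 1)
      + 2 * p.2 * (1 + p.1) * tailSumDeriv L (k - 1)
      + p.2 ^ 2 * (1 + p.1) * tailSum L (k - 1)

theorem tailSum_perm {L M : List (ℝ × ℝ)} (h : L.Perm M) :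
    tailSum L = tailSum M ∧ tailSumDeriv L = tailSumDeriv M ∧
      tailSumDeriv2 L = tailSumDeriv2 M := by
  induction h with
  | nil => exact ⟨rfl, rfl, rfl⟩
  | cons x _ ih =>
    obtain ⟨h0, h1, h2⟩ := ih
    refine ⟨?_, ?_, ?_⟩ <;> funext k <;> simp only [tailSum, tailSumDeriv, tailSumDeriv2, h0, h1, h2]
  | swap x y L =>
    refine ⟨?_, ?_, ?_⟩ <;> funext k <;> simp only [tailSum, tailSumDeriv, tailSumDeriv2] <;> ring
  | trans _ _ ih ih' =>
    exact ⟨ih.1.trans ih'.1, ih.2.1.trans ih'.2.1, ih.2.2.trans ih'.2.2⟩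

theorem tailSum_nonneg {L : List (ℝ × ℝ)} (h : ∀ p ∈ L, 0 < p.1) (k : ℕ) : 0 ≤ tailSum L k := by
  induction L generalizing k with
  | nil => unfold tailSum; split_ifs <;> norm_num
  | cons p L ih =>
    rw [List.forall_mem_cons] at h
    exact add_nonneg (ih h.2 k) (mul_nonneg h.1.le (ih h.2 (k - 1)))

theorem tailSum_pos {L : List (ℝ × ℝ)} (h : ∀ p ∈ L, 0 < p.1) {k : ℕ} (hk : k ≤ L.length) :
    0 < tailSum L k := by
  induction L generalizing k with
  | nil => simp_all [tailSum]
  | cons p L ih =>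
    rw [List.forall_mem_cons] at h
    rw [List.length_cons] at hk
    exact add_pos_of_nonneg_of_pos (tailSum_nonneg h.2 k) (mul_pos h.1 (ih h.2 (by omega)))

theorem tailSum_succ_le {L : List (ℝ × ℝ)} (h : ∀ p ∈ L, 0 < p.1) (k : ℕ) :
    tailSum L (k + 1) ≤ tailSum L k := by
  induction L generalizing k with
  | nil => unfold tailSum; split_ifs <;> simp_all
  | cons p L ih =>
    rw [List.forall_mem_cons] at h
    refine add_le_add (ih h.2 k) (mul_le_mul_of_nonneg_left ?_ h.1.le)
    cases k with
    | zero => exact le_rfl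
    | succ j => exact ih h.2 j

theorem tailSum_succ_lt {L : List (ℝ × ℝ)} (h : ∀ p ∈ L, 0 < p.1) {k : ℕ} (hk : k ≤ L.length) :
    tailSum L (k + 1) < tailSum L k := by
  induction L generalizing k with
  | nil => simp_all [tailSum]
  | cons p L ih =>
    rw [List.forall_mem_cons] at h
    rw [List.length_cons] at hk
    cases k with
    | zero => exact add_lt_add_of_lt_of_le (ih h.2 (Nat.zero_le _)) le_rfl
    | succ j =>
      exact add_lt_add_of_le_of_lt (tailSum_succ_le h.2 _)
        (mul_lt_mul_of_pos_left (ih h.2 (by omega)) h.1)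

theorem tailSum_eq_zero (L : List (ℝ × ℝ)) {k : ℕ} (hk : L.length < k) :
    tailSum L k = 0 ∧ tailSumDeriv L k = 0 ∧ tailSumDeriv2 L k = 0 := by
  induction L generalizing k with
  | nil =>
    have : k ≠ 0 := by rintro rfl; simp at hk
    simp [tailSum, tailSumDeriv, tailSumDeriv2, this]
  | cons p L ih =>
    rw [List.length_cons] at hk
    obtain ⟨h0, h1, h2⟩ := ih (k := k) (by omega)
    obtain ⟨g0, g1, g2⟩ := ih (k := k - 1) (by omega)
    simp [tailSum, tailSumDeriv, tailSumDeriv2, h0, h1, h2, g0, g1, g2]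

/-- At threshold 0 the tail sum is ∏ (1 + y), whose logarithm is linear in l; D is the sum of the
velocities. -/
theorem tailSum_zero_jet (L : List (ℝ × ℝ)) :
    ∃ D, tailSumDeriv L 0 = D * tailSum L 0 ∧ tailSumDeriv2 L 0 = D ^ 2 * tailSum L 0 := by
  induction L with
  | nil => exact ⟨0, by simp [tailSum, tailSumDeriv, tailSumDeriv2]⟩
  | cons p L ih =>
    obtain ⟨D, h1, h2⟩ := ih
    refine ⟨D + p.2, ?_, ?_⟩ <;>
      simp only [tailSum, tailSumDeriv, tailSumDeriv2, Nat.zero_sub, h1, h2] <;> ring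

/-- The jets of `tailSum` when pairs with `y = 0` are adjoined. -/
theorem tailSum_append_zeros {Z : List (ℝ × ℝ)} (hZ : ∀ p ∈ Z, p.1 = 0) (P : List (ℝ × ℝ)) :
    ∃ W V : ℝ, 0 ≤ V ∧ ∀ k, tailSum (Z ++ P) k = tailSum P k ∧
      tailSumDeriv (Z ++ P) k = tailSumDeriv P k + W * tailSum P (k - 1) ∧
      tailSumDeriv2 (Z ++ P) k = tailSumDeriv2 P k + 2 * W * tailSumDeriv P (k - 1)
        + V * tailSum P (k - 1) + (W ^ 2 - V) * tailSum P (k - 2) := by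
  induction Z with
  | nil => exact ⟨0, 0, le_rfl, fun k => by simp⟩
  | cons p Z ih =>
    rw [List.forall_mem_cons] at hZ
    obtain ⟨W, V, hV, h⟩ := ih hZ.2
    -- W and V are the sum and the sum of squares of the velocities in Z, so W² - V is twice their
    -- second elementary symmetric sum: two zero pairs leave 0 together.
    refine ⟨W + p.2, V + p.2 ^ 2, by positivity, fun k => ?_⟩
    obtain ⟨h0, h1, h2⟩ := h k
    obtain ⟨g0, g1, g2⟩ := h (k - 1)
    rw [Nat.sub_sub] at g1
    refine ⟨?_, ?_, ?_⟩ <;>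
      simp only [List.cons_append, tailSum, tailSumDeriv, tailSumDeriv2, hZ.1, h0, h1, h2, g0, g1] <;>
      ring

/-- The top jets of `tailSum` for a list of pairs with `y > 0`, expressed by sums over `1 / y`. -/
theorem tailSum_top_jet {P : List (ℝ × ℝ)} (hP : ∀ p ∈ P, 0 < p.1) :
    ∃ Y Z E U V X : ℝ, 0 ≤ E ∧
      (∀ w, 0 ≤ V + 2 * w * X + w ^ 2 * (Z + Z ^ 2 - 2 * E)) ∧ 0 ≤ Z ∧
      tailSum P P.length = Y ∧ tailSum P (P.length - 1) = Y * (1 + Z) ∧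
      tailSum P (P.length - 2) = Y * (1 + Z + E) ∧
      tailSumDeriv P P.length = Y * U ∧
      tailSumDeriv P (P.length - 1) = Y * ((1 + Z) * U - X) ∧
      tailSumDeriv2 P P.length = Y * (U ^ 2 - V) := by
  induction P with
  | nil => exact ⟨1, 0, 0, 0, 0, 0, by simp [tailSum, tailSumDeriv, tailSumDeriv2]⟩
  | cons p P ih =>
    rw [List.forall_mem_cons] at hP
    obtain ⟨Y, Z, E, U, V, X, hE, hV, hZ, h0, h1, h2, h3, h4, h5⟩ := ih hP.2
    obtain ⟨z0, z1, z2⟩ := tailSum_eq_zero P (k := P.length + 1) (by omega)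
    obtain ⟨y, d⟩ := p
    have hy : 0 < y := hP.1
    have hz : 0 < y⁻¹ := inv_pos.mpr hy
    have e1 : P.length + 1 - 2 = P.length - 1 := by omega
    have e2 : P.length - 1 - 1 = P.length - 2 := by omega
    -- Over the list, Y = ∏ y, Z = ∑ 1/y, E is the second elementary symmetric sum of the 1/y, U = ∑
    -- d (1 + 1/y), V = ∑ d² (1 + 1/y)/y and X = ∑ d (1 + 1/y)/y. As Z² - 2E = ∑ 1/y², the quadratic
    -- in w is ∑ (1 + 1/y)(d + w)²/y.
    refine ⟨Y * y, Z + y⁻¹, E + y⁻¹ * Z, U + d * (1 + y⁻¹), V + y⁻¹ * (1 + y⁻¹) * d ^ 2,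
      X + d * (1 + y⁻¹) * y⁻¹, by positivity, fun w => ?_, by positivity, ?_, ?_, ?_, ?_, ?_, ?_⟩
    · have := hV w
      have : 0 ≤ y⁻¹ * (1 + y⁻¹) * (d + w) ^ 2 := by positivity
      linarith
    all_goals
      simp only [tailSum, tailSumDeriv, tailSumDeriv2, List.length_cons, Nat.add_sub_cancel, e1, e2,
        h0, h1, h2, h3, h4, h5, z0, z1, z2]
      field_simp
      try ring

/-! ### The second-order inequality -/

/-- The right side minus the left is a quadratic in d with leading coefficient (1 + y) G (G - F) > 0
and a minimiser `w` free of y. Its minimum is a nonnegative combination of the defects in `hG2` and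
in `hw` at that `w`. -/
theorem logConcave_step {F F1 F2 G G1 G2 y d : ℝ} (hF : 0 < F) (hFG : F < G) (hy : 0 < y)
    (hw : ∀ w, F * (F2 + 2 * w * G1 + w ^ 2 * G) ≤ (F1 + w * G) ^ 2) (hG2 : G * G2 ≤ G1 ^ 2) :
    (F + y * G) * (F2 + y * G2 + 2 * d * (1 + y) * G1 + d ^ 2 * (1 + y) * G) ≤
      (F1 + y * G1 + d * (1 + y) * G) ^ 2 := by
  have hG : 0 < G := hF.trans hFG
  have hGF : 0 < G - F := sub_pos.mpr hFG
  have hGF' : G - F ≠ 0 := hGF.ne'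
  set w := (F * G1 - F1 * G) / (G * (G - F)) with hwdef
  have key : (F1 + y * G1 + d * (1 + y) * G) ^ 2 -
      (F + y * G) * (F2 + y * G2 + 2 * d * (1 + y) * G1 + d ^ 2 * (1 + y) * G) =
      (F + y * G) * y / G * (G1 ^ 2 - G * G2) +
      (F + y * G) / F * ((F1 + w * G) ^ 2 - F * (F2 + 2 * w * G1 + w ^ 2 * G)) +
      (1 + y) * (G - F) * G * (d - w) ^ 2 := by
    rw [hwdef]
    field_simp
    ring
  have h1 : 0 ≤ (F + y * G) * y / G * (G1 ^ 2 - G * G2) :=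
    mul_nonneg (by positivity) (sub_nonneg.mpr hG2)
  have h2 : 0 ≤ (F + y * G) / F * ((F1 + w * G) ^ 2 - F * (F2 + 2 * w * G1 + w ^ 2 * G)) :=
    mul_nonneg (by positivity) (sub_nonneg.mpr (hw w))
  have h3 : 0 ≤ (1 + y) * (G - F) * G * (d - w) ^ 2 := by positivity
  linarith

theorem tailSum_mul_deriv2_le {k : ℕ} {Z P : List (ℝ × ℝ)} (hZ : ∀ p ∈ Z, p.1 = 0)
    (hP : ∀ p ∈ P, 0 < p.1) (hk : k ≤ P.length) :
    tailSum (Z ++ P) k * tailSumDeriv2 (Z ++ P) k ≤ tailSumDeriv (Z ++ P) k ^ 2 := by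
  induction k generalizing Z P with
  | zero =>
    obtain ⟨D, h1, h2⟩ := tailSum_zero_jet (Z ++ P)
    rw [h1, h2]
    exact le_of_eq (by ring)
  | succ k ihk =>
    induction P generalizing Z with
    | nil => simp at hk
    | cons p P ihP =>
      rcases hk.eq_or_lt with hk | hk
      -- Threshold equal to the number of positive odds: the defect is Y² times the quadratic of
      -- `tailSum_top_jet` at W, plus Y² E (W² + T).
      · obtain ⟨W, T, hT, h⟩ := tailSum_append_zeros hZ (p :: P)
        obtain ⟨Y, S, E, U, V, X, hE, hV, -, h0, h1, h2, h3, h4, h5⟩ := tailSum_top_jet hP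
        obtain ⟨g0, g1, g2⟩ := h (k + 1)
        rw [g0, g1, g2, hk, h0, h1, h2, h3, h4, h5]
        have key := mul_nonneg (sq_nonneg Y) (add_nonneg (hV W)
          (mul_nonneg hE (add_nonneg (sq_nonneg W) hT)))
        linarith
      · rw [List.length_cons] at hk
        have hp := (List.forall_mem_cons.mp hP).1
        have hP' := (List.forall_mem_cons.mp hP).2
        obtain ⟨e0, e1, e2⟩ := tailSum_perm (List.perm_middle (a := p) (l₁ := Z) (l₂ := P))
        obtain ⟨W, T, hT, h⟩ := tailSum_append_zeros hZ P
        rw [e0, e1, e2]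
        simp only [tailSum, tailSumDeriv, tailSumDeriv2, Nat.add_sub_cancel]
        refine logConcave_step ?_ ?_ hp (fun w => ?_) (ihk hZ hP' (by omega))
        · rw [(h _).1]
          exact tailSum_pos hP' (by omega)
        · rw [(h _).1, (h _).1]
          exact tailSum_succ_lt hP' (by omega)
        -- The split-off pair is replaced by (0, w), which shortens P and lengthens Z; this is why Z
        -- is general in the induction.
        · have := ihP (Z := (0, w) :: Z) (List.forall_mem_cons.mpr ⟨rfl, hZ⟩) hP' (by omega)
          simpa [tailSum, tailSumDeriv, tailSumDeriv2] using this

/-! ### Concavity in the coordinates log (1 + y) -/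

/-- The list of pairs `(exp (l i) - 1, d i)` over a list of indices. -/
noncomputable def expPairs {ι : Type*} (I : List ι) (l d : ι → ℝ) : List (ℝ × ℝ) :=
  I.map fun i => (Real.exp (l i) - 1, d i)

theorem expPairs_pos {ι : Type*} (I : List ι) {l : ι → ℝ} (hl : ∀ i, 0 < l i) (d : ι → ℝ) :
    ∀ p ∈ expPairs I l d, 0 < p.1 := by
  intro p hp
  obtain ⟨i, -, rfl⟩ := List.mem_map.mp hp
  simpa using hl i

theorem hasDerivAt_tailSum_expPairs {ι : Type*} (I : List ι) (l d : ι → ℝ) (k : ℕ) (t : ℝ) :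
    HasDerivAt (fun t => tailSum (expPairs I (l + t • d) d) k)
      (tailSumDeriv (expPairs I (l + t • d) d) k) t ∧
    HasDerivAt (fun t => tailSumDeriv (expPairs I (l + t • d) d) k)
      (tailSumDeriv2 (expPairs I (l + t • d) d) k) t := by
  induction I generalizing k with
  | nil => exact ⟨hasDerivAt_const _ _, hasDerivAt_const _ _⟩
  | cons i I ih =>
    have hexp : HasDerivAt (fun t : ℝ => Real.exp ((l + t • d) i))
        (Real.exp ((l + t • d) i) * d i) t := by
      have : HasDerivAt (fun t : ℝ => (l + t • d) i) (d i) t := by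
        simpa using ((hasDerivAt_id t).mul_const (d i)).const_add (l i)
      exact this.exp
    have h1 := hexp.sub_const 1
    have h2 := hexp.const_mul (d i)
    obtain ⟨a0, a1⟩ := ih k
    obtain ⟨b0, b1⟩ := ih (k - 1)
    simp only [expPairs, List.map_cons, tailSum, tailSumDeriv, tailSumDeriv2,
      add_sub_cancel] at *
    constructor
    · refine (a0.add (h1.mul b0)).congr_deriv ?_
      ring
    · refine ((a1.add (h1.mul b1)).add (h2.mul b0)).congr_deriv ?_
      ring

theorem concaveOn_log_tailSum_expPairs {ι : Type*} (I : List ι) {k : ℕ} (hk : k ≤ I.length) :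
    ConcaveOn ℝ {l : ι → ℝ | ∀ i, 0 < l i}
      (fun l => Real.log (tailSum (expPairs I l 0) k)) := by
  have hconv : Convex ℝ {l : ι → ℝ | ∀ i, 0 < l i} := by
    intro x hx y hy a b ha hb hab i
    exact (convex_Ioi (0 : ℝ)) (hx i) (hy i) ha hb hab
  -- The velocities affect only the derivatives, so the direction of the line may be replaced by 0.
  have hindep : ∀ (J : List ι) (l d : ι → ℝ) (k : ℕ),
      tailSum (expPairs J l d) k = tailSum (expPairs J l 0) k := by
    intro J l d
    induction J with
    | nil => intro k; rfl
    | cons j J ih =>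
      intro k
      simp only [expPairs, List.map_cons, tailSum] at *
      rw [ih, ih]
  refine ⟨hconv, fun x hx y hy a b ha hb hab => ?_⟩
  set d := y - x with hd
  have hmem : ∀ t ∈ Set.Icc (0 : ℝ) 1, ∀ i, 0 < (x + t • d) i := by
    intro t ht
    have := hconv hx hy (sub_nonneg.mpr ht.2) ht.1 (sub_add_cancel 1 t)
    have e : x + t • d = (1 - t) • x + t • y := by rw [hd]; module
    rw [e]
    exact this
  have hpos : ∀ t ∈ Set.Icc (0 : ℝ) 1, 0 < tailSum (expPairs I (x + t • d) d) k := fun t ht =>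
    tailSum_pos (expPairs_pos I (hmem t ht) d) (by simpa [expPairs] using hk)
  have hline : ConcaveOn ℝ (Set.Icc (0 : ℝ) 1)
      (fun t => Real.log (tailSum (expPairs I (x + t • d) d) k)) := by
    refine concaveOn_of_hasDerivWithinAt2_nonpos (convex_Icc 0 1)
      (f' := fun t => tailSumDeriv (expPairs I (x + t • d) d) k /
        tailSum (expPairs I (x + t • d) d) k)
      (f'' := fun t => (tailSumDeriv2 (expPairs I (x + t • d) d) k *
        tailSum (expPairs I (x + t • d) d) k - tailSumDeriv (expPairs I (x + t • d) d) k *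
        tailSumDeriv (expPairs I (x + t • d) d) k) / tailSum (expPairs I (x + t • d) d) k ^ 2)
      ?_ ?_ ?_ ?_
    · intro t ht
      exact ((hasDerivAt_tailSum_expPairs I x d k t).1.log
        (hpos t ht).ne').continuousAt.continuousWithinAt
    · intro t ht
      exact ((hasDerivAt_tailSum_expPairs I x d k t).1.log
        (hpos t (interior_subset ht)).ne').hasDerivWithinAt
    · intro t ht
      obtain ⟨h0, h1⟩ := hasDerivAt_tailSum_expPairs I x d k t
      exact (h1.div h0 (hpos t (interior_subset ht)).ne').hasDerivWithinAt
    · intro t ht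
      have ht' := interior_subset ht
      have := tailSum_mul_deriv2_le (k := k) (Z := []) (by simp)
        (expPairs_pos I (hmem t ht') d) (by simpa [expPairs] using hk)
      rw [List.nil_append] at this
      exact div_nonpos_of_nonpos_of_nonneg (by linarith) (sq_nonneg _)
  have := hline.2 (Set.left_mem_Icc.mpr zero_le_one) (Set.right_mem_Icc.mpr zero_le_one) ha hb hab
  have e : x + b • d = a • x + b • y := by rw [hd, ← sub_eq_iff_eq_add.mpr hab.symm]; module
  simp only [hindep I _ d, smul_eq_mul, mul_zero, mul_one, zero_add, zero_smul, add_zero, one_smul,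
    e] at this
  simpa [hd] using this

/-! ### Monotonicity in the odds and composition with the allocation -/

/-- Higher odds make k wins no less likely, in cross-multiplied form. Raising one odds from y to z
gains (z - y)(S (k - 1) - S k), and S is antitone in the threshold. -/
theorem tailSum_mul_prod_le {ι : Type*} (I : List ι) {y z : ι → ℝ} (hy : ∀ i, 0 < y i)
    (hyz : ∀ i, y i ≤ z i) (k : ℕ) :
    tailSum (I.map fun i => (y i, 0)) k * (I.map fun i => 1 + z i).prod ≤
      tailSum (I.map fun i => (z i, 0)) k * (I.map fun i => 1 + y i).prod := by
  induction I generalizing k with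
  | nil => exact le_rfl
  | cons i I ih =>
    have hpos : ∀ p ∈ I.map fun i => (y i, (0 : ℝ)), 0 < p.1 := by
      intro p hp
      obtain ⟨j, -, rfl⟩ := List.mem_map.mp hp
      exact hy j
    have hle : tailSum (I.map fun i => (y i, 0)) k ≤ tailSum (I.map fun i => (y i, 0)) (k - 1) := by
      cases k with
      | zero => exact le_rfl
      | succ k => exact tailSum_succ_le hpos k
    have hprod : 0 ≤ (I.map fun i => 1 + z i).prod := by
      refine List.prod_nonneg fun a h => ?_
      obtain ⟨j, -, rfl⟩ := List.mem_map.mp h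
      linarith [hy j, hyz j]
    have hy' := hy i
    have hz' := hy'.trans_le (hyz i)
    have h1 := mul_nonneg (sub_nonneg.mpr (hyz i))
      (mul_nonneg (sub_nonneg.mpr hle) hprod)
    have h2 := mul_le_mul_of_nonneg_left (ih k) (by linarith : 0 ≤ 1 + y i)
    have h3 := mul_le_mul_of_nonneg_left (ih (k - 1)) (by positivity : 0 ≤ z i * (1 + y i))
    simp only [List.map_cons, tailSum, List.prod_cons]
    linarith

theorem sum_powerset_eq_tailSum {ι : Type*} [DecidableEq ι] (s : Finset ι) (y : ι → ℝ) (k : ℕ) :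
    ∑ w ∈ s.powerset with k ≤ w.card, ∏ i ∈ w, y i =
      tailSum (s.toList.map fun i => (y i, 0)) k := by
  induction s using Finset.induction_on generalizing k with
  | empty =>
    rw [Finset.sum_filter]
    simp [tailSum]
  | insert a s ha ih =>
    rw [(tailSum_perm ((Finset.toList_insert ha).map _)).1, List.map_cons, tailSum, ← ih, ← ih,
      Finset.sum_filter, Finset.sum_powerset_insert ha, Finset.sum_filter, Finset.sum_filter,
      Finset.mul_sum]
    congr 1
    refine Finset.sum_congr rfl fun w hw => ?_
    have haw : a ∉ w := fun h => ha (Finset.mem_powerset.mp hw h)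
    rw [Finset.card_insert_of_notMem haw, Finset.prod_insert haw]
    simp only [Nat.sub_le_iff_le_add, mul_ite, mul_zero]

theorem sum_coalitions_eq {ι : Type*} [Fintype ι] [DecidableEq ι] {y p q : ι → ℝ}
    (hp : ∀ i, p i = y i / (1 + y i)) (hq : ∀ i, q i = 1 / (1 + y i)) (k : ℕ) :
    ∑ w : Finset ι with k ≤ w.card, (∏ i ∈ w, p i) * ∏ j ∈ wᶜ, q j =
      tailSum (Finset.univ.toList.map fun i => (y i, 0)) k / ∏ i, (1 + y i) := by
  rw [← sum_powerset_eq_tailSum, Finset.powerset_univ, Finset.sum_div]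
  refine Finset.sum_congr rfl fun w _ => ?_
  simp only [hp, hq, Finset.prod_div_distrib, Finset.prod_const_one]
  rw [← Finset.prod_mul_prod_compl w fun i => 1 + y i, div_mul_div_comm, mul_one]

/-- A team that wins battle `i` with odds `a i * (x i / c i) ^ r i`, independently across battles,
wins at least `k` battles with a probability that is log-concave in `x`. -/
theorem logConcaveOn_of_odds {ι : Type*} [Fintype ι] [DecidableEq ι] {s : Set (ι → ℝ)}
    (hs : Convex ℝ s) (hspos : ∀ x ∈ s, ∀ i, 0 < x i) {a c r : ι → ℝ} (ha : ∀ i, 0 < a i)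
    (hc : ∀ i, 0 < c i) (hr : ∀ i, r i ∈ Set.Ioc (0 : ℝ) 1) {k : ℕ} (hk : k ≤ Fintype.card ι)
    {f : (ι → ℝ) → ℝ}
    (hf : ∀ x ∈ s, f x = tailSum (Finset.univ.toList.map fun i => (a i * (x i / c i) ^ r i, 0)) k /
      ∏ i, (1 + a i * (x i / c i) ^ r i)) :
    LogConcaveOn s f := by
  set y : (ι → ℝ) → ι → ℝ := fun x i => a i * (x i / c i) ^ r i
  set l : (ι → ℝ) → ι → ℝ := fun x i => Real.log (1 + y x i) with hl
  set I : List ι := Finset.univ.toList with hI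
  have hkI : k ≤ I.length := by simpa [hI] using hk
  have hypos : ∀ x ∈ s, ∀ i, 0 < y x i := fun x hx i =>
    mul_pos (ha i) (Real.rpow_pos_of_pos (div_pos (hspos x hx i) (hc i)) _)
  have hlpos : ∀ x ∈ s, ∀ i, 0 < l x i := fun x hx i =>
    Real.log_pos (by linarith [hypos x hx i])
  have hexp : ∀ x ∈ s, ∀ i, Real.exp (l x i) = 1 + y x i := fun x hx i =>
    Real.exp_log (by linarith [hypos x hx i])
  have hpairs : ∀ x ∈ s, (I.map fun i => (y x i, (0 : ℝ))) = expPairs I (l x) 0 := by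
    intro x hx
    simp [expPairs, hexp x hx]
  have hS : ∀ x ∈ s, 0 < tailSum (expPairs I (l x) 0) k := fun x hx =>
    tailSum_pos (expPairs_pos I (hlpos x hx) 0) (by simpa [expPairs] using hkI)
  have hprod : ∀ x ∈ s, 0 < ∏ i, (1 + y x i) := fun x hx =>
    Finset.prod_pos fun i _ => by linarith [hypos x hx i]
  have hfx : ∀ x ∈ s, f x = tailSum (expPairs I (l x) 0) k / ∏ i, (1 + y x i) := by
    intro x hx
    rw [hf x hx, ← hpairs x hx]
  have hlog : ∀ x ∈ s, Real.log (f x) =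
      Real.log (tailSum (expPairs I (l x) 0) k) - ∑ i, l x i := by
    intro x hx
    rw [hfx x hx, Real.log_div (hS x hx).ne' (hprod x hx).ne',
      Real.log_prod fun i _ => by linarith [hypos x hx i]]
  refine ⟨fun x hx => by rw [hfx x hx]; exact div_pos (hS x hx) (hprod x hx), hs, ?_⟩
  intro x hx x' hx' α β hα hβ hαβ
  have hm := hs hx hx' hα hβ hαβ
  set m := α • x + β • x' with hmdef
  set L := α • l x + β • l x' with hL
  have hLpos : ∀ i, 0 < L i := fun i =>
    (convex_Ioi (0 : ℝ)) (hlpos x hx i) (hlpos x' hx' i) hα hβ hαβ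
  -- Concavity of l in x: convexity of exp bounds exp (L i) by the mean of the 1 + y, and y is
  -- concave in x since r ≤ 1.
  have hLy : ∀ i, Real.exp (L i) - 1 ≤ y m i := by
    intro i
    have h1 := convexOn_exp.2 (Set.mem_univ (l x i)) (Set.mem_univ (l x' i)) hα hβ hαβ
    have h2 := (Real.concaveOn_rpow (hr i).1.le (hr i).2).2
      (div_pos (hspos x hx i) (hc i)).le (div_pos (hspos x' hx' i) (hc i)).le hα hβ hαβ
    have h3 : m i / c i = α * (x i / c i) + β * (x' i / c i) := by
      simp only [hmdef, Pi.add_apply, Pi.smul_apply, smul_eq_mul]; ring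
    simp only [smul_eq_mul, hexp x hx, hexp x' hx'] at h1
    simp only [smul_eq_mul, ← h3] at h2
    have h4 := mul_le_mul_of_nonneg_left h2 (ha i).le
    have h5 : L i = α * l x i + β * l x' i := rfl
    rw [h5]
    have h6 : y x i = a i * (x i / c i) ^ r i := rfl
    have h7 : y x' i = a i * (x' i / c i) ^ r i := rfl
    have h8 : y m i = a i * (m i / c i) ^ r i := rfl
    rw [h6, h7] at h1
    rw [h8]
    linarith
  have hSL : 0 < tailSum (expPairs I L 0) k :=
    tailSum_pos (expPairs_pos I hLpos 0) (by simpa [expPairs] using hkI)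
  have hmono := tailSum_mul_prod_le I (fun i => by simpa using hLpos i) hLy k
  simp only [add_sub_cancel, hI, Finset.prod_map_toList] at hmono
  have hfm : tailSum (expPairs I L 0) k / ∏ i, Real.exp (L i) ≤ f m := by
    rw [hf m hm, div_le_div_iff₀ (Finset.prod_pos fun i _ => Real.exp_pos _) (hprod m hm)]
    exact hmono
  have hE : 0 < ∏ i, Real.exp (L i) := Finset.prod_pos fun i _ => Real.exp_pos _
  have hlogm := Real.log_le_log (div_pos hSL hE) hfm
  rw [Real.log_div hSL.ne' hE.ne', ← Real.exp_sum, Real.log_exp] at hlogm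
  have hconc := (concaveOn_log_tailSum_expPairs I hkI).2 (hlpos x hx) (hlpos x' hx') hα hβ hαβ
  have hsum : ∑ i, L i = α * ∑ i, l x i + β * ∑ i, l x' i := by
    simp only [hL, Pi.add_apply, Pi.smul_apply, smul_eq_mul, Finset.sum_add_distrib,
      Finset.mul_sum]
  simp only [hlog x hx, hlog x' hx', smul_eq_mul] at hconc ⊢
  linarith

theorem mainTheorem2 (N : ℕ) (hN : 1 ≤ N)
    (c : Team → Fin (2 * N + 1) → ℝ) (hc : ∀ i t, 0 < c i t)
    (r : Fin (2 * N + 1) → ℝ) (hr : ∀ t, r t ∈ Set.Ioc (0 : ℝ) 1)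
    (W : Team → ℝ) (hW : ∀ i, 0 < W i)
    (i : Team) (v : Team → Fin (2 * N + 1) → ℝ)
    (hv : v i.rival ∈ interiorAllocations N (W i.rival)) :
    LogConcaveOn (interiorAllocations N (W i))
      (fun x => contestProb c r (Function.update v i x) i) := by
  have hvpos := ((mem_interiorAllocations_iff (hW i.rival) _).mp hv).1
  have hpos : ∀ x ∈ interiorAllocations N (W i), ∀ t, 0 < x t := fun x hx =>
    ((mem_interiorAllocations_iff (hW i) x).mp hx).1
  have hconv : Convex ℝ (interiorAllocations N (W i)) := by
    intro x hx y hy a b ha hb hab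
    rw [mem_interiorAllocations_iff (hW i)] at hx hy ⊢
    refine ⟨fun t => (convex_Ioi (0 : ℝ)) (hx.1 t) (hy.1 t) ha hb hab, ?_⟩
    simp only [Pi.add_apply, Pi.smul_apply, smul_eq_mul, Finset.sum_add_distrib, ← Finset.mul_sum,
      hx.2, hy.2]
    rw [← add_mul, hab, one_mul]
  have hrival : ∀ t, 0 < (v i.rival t / c i.rival t) ^ r t := fun t =>
    Real.rpow_pos_of_pos (div_pos (hvpos t) (hc _ t)) _
  -- Against a fixed rival the odds are the team's own power term times the inverse of the rival's,
  -- for A and B alike.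
  refine logConcaveOn_of_odds hconv hpos
    (a := fun t => ((v i.rival t / c i.rival t) ^ r t)⁻¹) (fun t => inv_pos.mpr (hrival t)) (hc i) hr
    (k := N + 1) (by rw [Fintype.card_fin]; omega) fun x hx => ?_
  have hown : ∀ t, 0 < (x t / c i t) ^ r t := fun t =>
    Real.rpow_pos_of_pos (div_pos (hpos x hx t) (hc i t)) _
  refine sum_coalitions_eq (fun t => ?_) (fun t => ?_) (N + 1)
  all_goals
    have h1 := hown t
    have h2 := hrival t
    cases i <;>
      simp only [Team.rival, battleProb, battleProbA, Function.update_self, ne_eq, reduceCtorEq,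
        not_false_eq_true, Function.update_of_ne] at h1 h2 ⊢ <;>
      field_simp <;> ring
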